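/- Let $n\ge 2$, let $S^{n-1}$ be the unit sphere of $\mathbb R^n$ with the standard inner product $x\cdot y$. A finite non-empty set $Y\subset S^{n-1}$ is a *spherical design of harmonic index $t$* if $\sum_{x\in Y}f(x)=0$ for every real homogeneous polynomial $f(x_1,\dots,x_n)$ of degree $t$ with $\sum_i\partial^2 f/\partial x_i^2=0$. Let $Q_{n,k}$ be the Gegenbauer polynomials defined by $Q_{n,0}=1$, $Q_{n,1}=nx$ and $\lambda_{k+2}Q_{n,k+2}=xQ_{n,k+1}-(1-\lambda_k)Q_{n,k}$ for $k\ge 0$, where $\lambda_k=k/(n+2k-2)$ (and $\lambda_0=0$). Put $$c_{n,t}=-\min_{-1\le x\le 1}Q_{n,t}(x),\qquad b_{n,t}=1+\frac{Q_{n,t}(1)}{c_{n,t}},\qquad I(Y)=\{x\cdot y: x,y\in Y,\ x\ne y\}.$$ A design $Y$ of harmonic index $t$ is *tight* if $|Y|=b_{n,t}$. Let $\alpha_n>0$ be given by $$\alpha_n^2=\frac{5(n+6)+\sqrt{10(n+3)(n+6)}}{(n+6)(n+8)}.$$ Then the following hold. 1. For every $n\ge 3$ there is no tight spherical design of harmonic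 index $6$ on $S^{n-1}$. 2. A finite set $Y\subset\mathbb R^2$ is a tight spherical design of harmonic index $6$ on $S^1$ if and only if $Y=\{y_1,y_2\}$ for two unit vectors $y_1,y_2$ whose angle is $j\pi/6$ for some odd $j$. 3. For every $n\ge 2$ and every spherical design $Y\subset S^{n-1}$ of harmonic index $6$ one has $|Y|\ge b_{n,6}$, and $Y$ is tight if and only if $Q_{n,6}(a)=-c_{n,6}$ for all $a\in I(Y)$. 4. For every $n\ge 3$ the set of $x\in[-1,1]$ with $Q_{n,6}(x)=-c_{n,6}$ is exactly $\{\alpha_n,-\alpha_n\}$. 5. For every $n\ge 3$, a tight spherical design $Y$ of harmonic index $6$ on $S^{n-1}$ would satisfy $I(Y)=\{\alpha_n,-\alpha_n\}$ and $|Y|=b_{n,6}$. 6. For every $n\ge 2$, $$c_{n,6}=\frac{n(n+2)(n+10)\left(2(n-2)(n+3)(n+6)+(n+3)(n+4)\sqrt{10(n+3)(n+6)}\right)}{36(n+6)(n+8)^2},$$ $$b_{n,6}=\frac{(n+4)\left(20\sqrt{10(n+3)(n+6)}+(n+3)(n+6)(n^2+9n-12)\right)}{20\left(2(n-2)(n+6)+(n+4)\sqrt{10(n+3)(n+6)}\right)}.$$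 7. For every $n\ge 37$, $b_{n,6}>\frac{n(n+1)}2$. 8. For $2\le n\le 36$, $b_{n,6}$ is an integer if and only if $n=2$ or $n=24$; moreover $b_{2,6}=2$ and $b_{24,6}=231$. -/

import Mathlib

namespace HarmonicIndex

/-- The coefficients `λ_k = k / (n + 2k - 2)` of the three-term recurrence of the Gegenbauer
polynomials on the sphere in `ℝⁿ` (for `n = 2` one has `λ_0 = 0`, which is also what the
convention `0 / 0 = 0` gives). -/
noncomputable def gegenbauerCoeff (n k : ℕ) : ℝ :=
  (k : ℝ) / ((n : ℝ) + 2 * (k : ℝ) - 2)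

/-- The Gegenbauer polynomials `Q_{n,k}` in the Delsarte–Goethals–Seidel normalization:
`Q_{n,0} = 1`, `Q_{n,1} = n x`, and
`λ_{k+2} Q_{n,k+2} = x Q_{n,k+1} - (1 - λ_k) Q_{n,k}`; then `Q_{n,k}(1) = dim Harm_k(ℝⁿ)`. -/
noncomputable def gegenbauer (n : ℕ) : ℕ → Polynomial ℝ
  | 0 => 1
  | 1 => Polynomial.C (n : ℝ) * Polynomial.X
  | k + 2 =>
    Polynomial.C (gegenbauerCoeff n (k + 2))⁻¹ *
      (Polynomial.X * gegenbauer n (k + 1)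
        - Polynomial.C (1 - gegenbauerCoeff n k) * gegenbauer n k)

/-- A real polynomial in `n` indeterminates is harmonic if its Laplacian vanishes. -/
def IsHarmonicPoly {n : ℕ} (f : MvPolynomial (Fin n) ℝ) : Prop :=
  ∑ i : Fin n, MvPolynomial.pderiv i (MvPolynomial.pderiv i f) = 0

/-- A finite non-empty subset `Y` of the unit sphere of `ℝⁿ` is a spherical design of harmonic
index `t` if every homogeneous harmonic polynomial of degree `t` sums to zero over `Y`. -/
structure IsDesign {n : ℕ} (t : ℕ) (Y : Finset (EuclideanSpace ℝ (Fin n))) : Prop where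
  nonempty : Y.Nonempty
  on_sphere : ∀ x ∈ Y, ‖x‖ = 1
  sum_eq_zero : ∀ f : MvPolynomial (Fin n) ℝ, f.IsHomogeneous t → IsHarmonicPoly f →
    ∑ x ∈ Y, MvPolynomial.eval (fun i => x i) f = 0

/-- `c_{n,t} = - min_{-1 ≤ x ≤ 1} Q_{n,t}(x)`. -/
noncomputable def c (n t : ℕ) : ℝ :=
  -sInf ((fun x : ℝ => (gegenbauer n t).eval x) '' Set.Icc (-1) 1)

/-- The Fisher type lower bound `b_{n,t} = 1 + Q_{n,t}(1) / c_{n,t}`. -/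
noncomputable def b (n t : ℕ) : ℝ :=
  1 + (gegenbauer n t).eval 1 / c n t

/-- A design of harmonic index `t` is tight if its size attains the bound `b_{n,t}`. -/
def IsTight {n : ℕ} (t : ℕ) (Y : Finset (EuclideanSpace ℝ (Fin n))) : Prop :=
  IsDesign t Y ∧ (Y.card : ℝ) = b n t

/-- `I(Y)`, the set of inner products of pairs of distinct elements of `Y`. -/
def innerProducts {n : ℕ} (Y : Finset (EuclideanSpace ℝ (Fin n))) : Set ℝ :=
  {a | ∃ x ∈ Y, ∃ y ∈ Y, x ≠ y ∧ inner ℝ x y = a}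

/-- The number `α > 0` with
`α² = (5(n+6) + √(10(n+3)(n+6))) / ((n+6)(n+8))`. -/
noncomputable def alpha (n : ℕ) : ℝ :=
  √((5 * ((n : ℝ) + 6) + √(10 * ((n : ℝ) + 3) * ((n : ℝ) + 6))) /
    (((n : ℝ) + 6) * ((n : ℝ) + 8)))

end HarmonicIndex

namespace HarmonicIndex

open Finset MvPolynomial

/-! For unit vectors, `Q_{n,6}(x · y)` is a harmonic form of degree 6 in `x`, so its sum over all
ordered pairs of a design `Y` is zero. The diagonal contributes `|Y| Q_{n,6}(1)` and every other
term is at least `-c_{n,6}`; this gives `|Y| ≥ b_{n,6}`, with equality exactly when every inner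
product of distinct points is a minimiser of `Q_{n,6}` (`IsDesign.sum_offDiag`).

The minimum comes from viewing `Q_{n,6} + c_{n,6}` as a cubic in `x ^ 2` with a double root `α ^ 2`
(`gegenbauer_six_add_minValue`). For `n ≥ 3` the minimisers are `±α`, so a tight design spans
equiangular lines and `|Y| ≤ n(n+1)/2` by `card_le_of_equiangular`. This contradicts
`triangular_lt_b_six` when `n ≥ 37`. Below 37 the number `b_{n,6}` is not an integer, except for `n
= 24`, where `α = 1/2` and a parity argument (`card_le_of_inner_eq_half`) gives `|Y| ≤ 25 < 231`.

On the circle `Q_{2,6}(cos θ) = 2 cos 6θ` and `b_{2,6} = 2`. Harmonic forms of degree 6 are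
combinations of the real and imaginary parts of `z ^ 6`, so two distinct unit vectors form a design
when their sixth powers are opposite. -/

/-! ### The polynomial `Q_{n,6}` and its minimum. -/

theorem gegenbauer_six_eval {n : ℕ} (hn : 2 ≤ n) (x : ℝ) :
    (gegenbauer n 6).eval x = (n : ℝ) * (n + 2) * (n + 10) / 720 *
      (((n : ℝ) + 4) * (n + 6) * (n + 8) * x ^ 6 - 15 * (n + 4) * (n + 6) * x ^ 4
        + 45 * (n + 4) * x ^ 2 - 15) := by
  have hN : (2 : ℝ) ≤ n := by exact_mod_cast hn
  generalize hNn : (n : ℝ) = N at *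
  have h0 : gegenbauerCoeff n 0 = 0 := by simp [gegenbauerCoeff]
  have h1 : gegenbauerCoeff n 1 = 1 / N := by
    simp only [gegenbauerCoeff, hNn]; push_cast; congr 1; ring
  have h2 : gegenbauerCoeff n 2 = 2 / (N + 2) := by
    simp only [gegenbauerCoeff, hNn]; push_cast; congr 1; ring
  have h3 : gegenbauerCoeff n 3 = 3 / (N + 4) := by
    simp only [gegenbauerCoeff, hNn]; push_cast; congr 1; ring
  have h4 : gegenbauerCoeff n 4 = 4 / (N + 6) := by
    simp only [gegenbauerCoeff, hNn]; push_cast; congr 1; ring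
  have h5 : gegenbauerCoeff n 5 = 5 / (N + 8) := by
    simp only [gegenbauerCoeff, hNn]; push_cast; congr 1; ring
  have h6 : gegenbauerCoeff n 6 = 6 / (N + 10) := by
    simp only [gegenbauerCoeff, hNn]; push_cast; congr 1; ring
  simp only [gegenbauer, Nat.reduceAdd, zero_add, h0, h1, h2, h3, h4, h5, h6,
    Polynomial.eval_mul, Polynomial.eval_sub, Polynomial.eval_C, Polynomial.eval_X,
    Polynomial.eval_one, hNn]
  have : N ≠ 0 := by positivity
  have : N + 2 ≠ 0 := by positivity
  have : N + 4 ≠ 0 := by positivity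
  have : N + 6 ≠ 0 := by positivity
  have : N + 8 ≠ 0 := by positivity
  have : N + 10 ≠ 0 := by positivity
  field_simp
  ring

/-- The radical `√(10 (n + 3) (n + 6))`. -/
noncomputable def radical (n : ℕ) : ℝ := √(10 * ((n : ℝ) + 3) * ((n : ℝ) + 6))

theorem radical_sq (n : ℕ) : radical n ^ 2 = 10 * ((n : ℝ) + 3) * ((n : ℝ) + 6) :=
  Real.sq_sqrt (by positivity)

theorem radical_pos (n : ℕ) : 0 < radical n := Real.sqrt_pos.2 (by positivity)

theorem alpha_pos (n : ℕ) : 0 < alpha n := Real.sqrt_pos.2 (by positivity)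

theorem alpha_sq (n : ℕ) : alpha n ^ 2 =
    (5 * ((n : ℝ) + 6) + radical n) / (((n : ℝ) + 6) * ((n : ℝ) + 8)) :=
  Real.sq_sqrt (by positivity)

theorem alpha_lt_one {n : ℕ} (hn : 2 ≤ n) : alpha n < 1 := by
  have hN : (2 : ℝ) ≤ n := by exact_mod_cast hn
  have hs := radical_sq n
  have hp := radical_pos n
  have h : alpha n ^ 2 < 1 := by
    rw [alpha_sq, div_lt_one (by positivity)]
    have : radical n < (n + 6) * (n + 3) := by
      apply lt_of_pow_lt_pow_left₀ 2 (by positivity)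
      rw [hs]
      have : 10 ≤ ((n : ℝ) + 3) * (n + 6) := by nlinarith
      nlinarith [mul_pos (show (0:ℝ) < n + 3 by linarith) (show (0:ℝ) < n + 6 by linarith)]
    nlinarith
  nlinarith [alpha_pos n]

/-- The closed form of the negative of the minimum of `Q_{n,6}`. -/
noncomputable def minValue (n : ℕ) : ℝ :=
  (n : ℝ) * (n + 2) * (n + 10) *
    (2 * ((n : ℝ) - 2) * (n + 3) * (n + 6) + ((n : ℝ) + 3) * (n + 4) * radical n) /
    (36 * ((n : ℝ) + 6) * ((n : ℝ) + 8) ^ 2)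

/-- In `u = x ^ 2` the derivative of the cubic vanishes where `(n+6)(n+8)u² - 10(n+6)u + 15 = 0`;
the larger root is `α ^ 2`, a double root once the minimum is subtracted. The roots of the cubic sum
to `15 / (n + 8)`, which determines the last factor. -/
theorem gegenbauer_six_add_minValue {n : ℕ} (hn : 2 ≤ n) (x : ℝ) :
    (gegenbauer n 6).eval x + minValue n =
      (n : ℝ) * (n + 2) * (n + 10) / 720 * (((n : ℝ) + 4) * (n + 6) * (n + 8)) *
      ((x ^ 2 - alpha n ^ 2) ^ 2 *
        (x ^ 2 + (2 * radical n - 5 * ((n : ℝ) + 6)) / (((n : ℝ) + 6) * ((n : ℝ) + 8)))) := by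
  rw [gegenbauer_six_eval hn, alpha_sq, minValue]
  have hs := radical_sq n
  have hs3 : radical n ^ 3 = 10 * ((n : ℝ) + 3) * ((n : ℝ) + 6) * radical n := by
    rw [pow_succ, hs]
  generalize radical n = s at *
  have hN : (2 : ℝ) ≤ n := by exact_mod_cast hn
  generalize (n : ℝ) = N at *
  have h6 : N + 6 ≠ 0 := by positivity
  have h8 : N + 8 ≠ 0 := by positivity
  field_simp
  ring_nf
  rw [hs3, hs]
  ring

/-- Sign of the remaining factor in `gegenbauer_six_add_minValue`. Equality holds at `n = 2`, where
that factor is `x ^ 2` and `0` becomes a further minimiser; hence the strict version starts at `n =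
3`. -/
theorem two_mul_radical_ge {n : ℕ} (hn : 2 ≤ n) : 5 * ((n : ℝ) + 6) ≤ 2 * radical n := by
  have hN : (2 : ℝ) ≤ n := by exact_mod_cast hn
  refine le_of_pow_le_pow_left₀ two_ne_zero (by linarith [radical_pos n]) ?_
  nlinarith [radical_sq n]

theorem two_mul_radical_gt {n : ℕ} (hn : 3 ≤ n) : 5 * ((n : ℝ) + 6) < 2 * radical n := by
  have hN : (3 : ℝ) ≤ n := by exact_mod_cast hn
  apply lt_of_pow_lt_pow_left₀ 2 (by linarith [radical_pos n])
  rw [mul_pow _ (radical n), radical_sq n]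
  nlinarith

theorem neg_minValue_le {n : ℕ} (hn : 2 ≤ n) (x : ℝ) :
    -minValue n ≤ (gegenbauer n 6).eval x := by
  have h := gegenbauer_six_add_minValue hn x
  have hw : 0 ≤ (2 * radical n - 5 * ((n : ℝ) + 6)) / (((n : ℝ) + 6) * ((n : ℝ) + 8)) :=
    div_nonneg (by linarith [two_mul_radical_ge hn]) (by positivity)
  have : 0 ≤ (gegenbauer n 6).eval x + minValue n := by rw [h]; positivity
  linarith

theorem gegenbauer_six_alpha {n : ℕ} (hn : 2 ≤ n) :
    (gegenbauer n 6).eval (alpha n) = -minValue n := by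
  have h := gegenbauer_six_add_minValue hn (alpha n)
  simp only [sub_self] at h
  linarith

theorem gegenbauer_six_eq_iff {n : ℕ} (hn : 3 ≤ n) (x : ℝ) :
    (gegenbauer n 6).eval x = -minValue n ↔ x = alpha n ∨ x = -alpha n := by
  have h := gegenbauer_six_add_minValue (by omega : 2 ≤ n) x
  have hw : 0 < (2 * radical n - 5 * ((n : ℝ) + 6)) / (((n : ℝ) + 6) * ((n : ℝ) + 8)) :=
    div_pos (by linarith [two_mul_radical_gt hn]) (by positivity)
  have hn0 : (0 : ℝ) < n := by exact_mod_cast (by omega : 0 < n)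
  have hK : (n : ℝ) * (n + 2) * (n + 10) / 720 * (((n : ℝ) + 4) * (n + 6) * (n + 8)) ≠ 0 := by
    positivity
  have hu : x ^ 2 + (2 * radical n - 5 * ((n : ℝ) + 6)) / (((n : ℝ) + 6) * ((n : ℝ) + 8)) ≠ 0 := by
    positivity
  rw [← add_eq_zero_iff_eq_neg, h, mul_eq_zero, or_iff_right hK, mul_eq_zero, or_iff_left hu,
    sq_eq_zero_iff, sub_eq_zero, sq_eq_sq_iff_eq_or_eq_neg]

theorem c_six {n : ℕ} (hn : 2 ≤ n) : c n 6 = minValue n := by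
  have : IsLeast ((fun x : ℝ => (gegenbauer n 6).eval x) '' Set.Icc (-1) 1) (-minValue n) := by
    refine ⟨⟨alpha n, ⟨?_, (alpha_lt_one hn).le⟩, gegenbauer_six_alpha hn⟩, ?_⟩
    · linarith [alpha_pos n]
    · rintro _ ⟨x, -, rfl⟩
      exact neg_minValue_le hn x
  rw [c, this.csInf_eq, neg_neg]

theorem c_six_pos {n : ℕ} (hn : 2 ≤ n) : 0 < c n 6 := by
  rw [c_six hn, minValue]
  have hN : (2 : ℝ) ≤ n := by exact_mod_cast hn
  have h2 : (0 : ℝ) ≤ n - 2 := by linarith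
  have := radical_pos n
  positivity

/-! ### The number `b_{n,6}`: closed form, growth and integrality. -/

theorem gegenbauer_six_one {n : ℕ} (hn : 2 ≤ n) :
    (gegenbauer n 6).eval 1 =
      ((n : ℝ) - 1) * n * (n + 1) * (n + 2) * (n + 3) * (n + 10) / 720 := by
  rw [gegenbauer_six_eval hn]; ring

/-- The denominator of the closed form of `b_{n,6}` is positive. -/
theorem denominator_pos {n : ℕ} (hn : 2 ≤ n) :
    0 < 20 * (2 * ((n : ℝ) - 2) * (n + 6) + ((n : ℝ) + 4) * radical n) := by
  have hN : (2 : ℝ) ≤ n := by exact_mod_cast hn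
  have h2 : (0 : ℝ) ≤ n - 2 := by linarith
  have := radical_pos n
  positivity

theorem b_six {n : ℕ} (hn : 2 ≤ n) : b n 6 =
    ((n : ℝ) + 4) * (20 * radical n + ((n : ℝ) + 3) * (n + 6) * ((n : ℝ) ^ 2 + 9 * n - 12)) /
      (20 * (2 * ((n : ℝ) - 2) * (n + 6) + ((n : ℝ) + 4) * radical n)) := by
  have hd := (denominator_pos hn).ne'
  have hc := (c_six_pos hn).ne'
  rw [b, gegenbauer_six_one hn, ← sub_eq_zero]
  rw [c_six hn] at *
  rw [minValue] at *
  have hN : (2 : ℝ) ≤ n := by exact_mod_cast hn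
  have hs := radical_sq n
  generalize radical n = s at *
  generalize (n : ℝ) = N at *
  have hE : 2 * (N - 2) * (N + 6) + (N + 4) * s ≠ 0 := fun h => hd (by rw [h, mul_zero])
  have h3 : N + 3 ≠ 0 := by positivity
  have hf : 2 * (N - 2) * (N + 3) * (N + 6) + (N + 3) * (N + 4) * s =
    (N + 3) * (2 * (N - 2) * (N + 6) + (N + 4) * s) := by ring
  rw [hf]
  have h6 : N + 6 ≠ 0 := by positivity
  have h8 : N + 8 ≠ 0 := by positivity
  have h2 : N + 2 ≠ 0 := by positivity
  have h0 : N ≠ 0 := by positivity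
  have h10 : N + 10 ≠ 0 := by positivity
  field_simp
  ring_nf

theorem triangular_lt_b_six {n : ℕ} (hn : 37 ≤ n) : (n : ℝ) * (n + 1) / 2 < b n 6 := by
  rw [b_six (by omega), lt_div_iff₀ (denominator_pos (by omega))]
  -- `√((n+3)(n+6)) ≤ n + 9/2` by AM-GM, and `√10 < 3.1623`. An upper bound suffices because the
  -- radical enters the cleared inequality with a negative coefficient.
  have hs : radical n ≤ 31623 / 10000 * (n + 9 / 2) := by
    refine le_of_pow_le_pow_left₀ two_ne_zero (by positivity) ?_
    nlinarith [radical_sq n]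
  -- In `m = n - 37` the quintic left after bounding the radical has only positive coefficients.
  obtain ⟨m, rfl⟩ := Nat.exists_eq_add_of_le hn
  push_cast at *
  have hm : (0 : ℝ) ≤ m := by positivity
  generalize radical _ = s at *
  generalize (m : ℝ) = m at *
  have h : (0 : ℝ) ≤ (m + 41) * (10 * ((37 + m) * (37 + m + 1) - 2)) *
    (31623 / 10000 * (37 + m + 9 / 2) - s) :=
    mul_nonneg (mul_nonneg (by linarith) (by nlinarith)) (by linarith)
  rw [← sub_pos]
  nlinarith [h, pow_nonneg hm 2, pow_nonneg hm 3, pow_nonneg hm 4, pow_nonneg hm 5]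

/-- Integer certificate for `b_{n,6}` to lie strictly between `k` and `k + 1`, where `p / 1000` and
`(p + 1) / 1000` enclose the radical. -/
theorem b_six_mem_Ioo {n : ℕ} (hn : 2 ≤ n) (p k : ℕ)
    (h₁ : p ^ 2 ≤ 10 ^ 7 * (n + 3) * (n + 6)) (h₂ : 10 ^ 7 * (n + 3) * (n + 6) ≤ (p + 1) ^ 2)
    (h₃ : (k : ℤ) * (20 * (2000 * ((n : ℤ) - 2) * (n + 6) + (n + 4) * (p + 1))) <
      ((n : ℤ) + 4) * (20 * p + 1000 * (n + 3) * (n + 6) * ((n : ℤ) ^ 2 + 9 * n - 12)))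
    (h₄ : ((n : ℤ) + 4) *
        (20 * (p + 1) + 1000 * (n + 3) * (n + 6) * ((n : ℤ) ^ 2 + 9 * n - 12)) <
      ((k : ℤ) + 1) * (20 * (2000 * ((n : ℤ) - 2) * (n + 6) + (n + 4) * p))) :
    (k : ℝ) < b n 6 ∧ b n 6 < k + 1 := by
  have hs := radical_sq n
  have h₁' : ((p : ℝ) / 1000) ≤ radical n := by
    refine le_of_pow_le_pow_left₀ two_ne_zero (radical_pos n).le ?_
    have : (p : ℝ) ^ 2 ≤ 10 ^ 7 * (n + 3) * (n + 6) := by exact_mod_cast h₁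
    rw [hs]; linarith
  have h₂' : radical n ≤ ((p : ℝ) + 1) / 1000 := by
    refine le_of_pow_le_pow_left₀ two_ne_zero (by positivity) ?_
    have : 10 ^ 7 * ((n : ℝ) + 3) * (n + 6) ≤ (p + 1) ^ 2 := by exact_mod_cast h₂
    rw [hs]; linarith
  have h₃' : (k : ℝ) * (20 * (2000 * ((n : ℝ) - 2) * (n + 6) + (n + 4) * (p + 1))) <
      ((n : ℝ) + 4) * (20 * p + 1000 * (n + 3) * (n + 6) * ((n : ℝ) ^ 2 + 9 * n - 12)) := by
    have := (Int.cast_lt (R := ℝ)).2 h₃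
    push_cast at this
    exact this
  have h₄' : ((n : ℝ) + 4) *
        (20 * (p + 1) + 1000 * (n + 3) * (n + 6) * ((n : ℝ) ^ 2 + 9 * n - 12)) <
      ((k : ℝ) + 1) * (20 * (2000 * ((n : ℝ) - 2) * (n + 6) + (n + 4) * p)) := by
    have := (Int.cast_lt (R := ℝ)).2 h₄
    push_cast at this
    exact this
  have hn4 : (0 : ℝ) ≤ n + 4 := by positivity
  have hk : (0 : ℝ) ≤ k := by positivity
  rw [b_six hn, lt_div_iff₀ (denominator_pos hn), div_lt_iff₀ (denominator_pos hn)]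
  constructor
  -- Numerator and denominator both increase with the radical, so each is bounded at the opposite
  -- end of the enclosing interval.
  · have h₅ := mul_le_mul_of_nonneg_left h₁' hn4
    have h₆ := mul_le_mul_of_nonneg_left (mul_le_mul_of_nonneg_left h₂' hn4) hk
    linarith
  · have h₅ := mul_le_mul_of_nonneg_left h₂' hn4
    have h₆ := mul_le_mul_of_nonneg_left (mul_le_mul_of_nonneg_left h₁' hn4)
      (by linarith : (0 : ℝ) ≤ k + 1)
    linarith

theorem b_six_not_int {n : ℕ} (hn : 3 ≤ n) (hn' : n ≤ 36) (h24 : n ≠ 24) (m : ℤ) :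
    b n 6 ≠ m := by
  -- Here `p` is the integer part of 1000 times the radical, and `k` is the resulting candidate for
  -- the integer part of `b_{n,6}`. Quantifying over one-element lists names them while keeping the
  -- statement decidable.
  have H : ∀ n ∈ Finset.Icc 3 36, n ≠ 24 → ∃ p ∈ [Nat.sqrt (10 ^ 7 * (n + 3) * (n + 6))],
      ∃ k ∈ ([(n + 4) * (20 * p + 1000 * (n + 3) * (n + 6) * (n ^ 2 + 9 * n - 12)) /
        (20 * (2000 * (n - 2) * (n + 6) + (n + 4) * p))] : List ℕ),
      p ^ 2 ≤ 10 ^ 7 * (n + 3) * (n + 6) ∧ 10 ^ 7 * (n + 3) * (n + 6) ≤ (p + 1) ^ 2 ∧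
      (k : ℤ) * (20 * (2000 * ((n : ℤ) - 2) * (n + 6) + (n + 4) * (p + 1))) <
        ((n : ℤ) + 4) * (20 * p + 1000 * (n + 3) * (n + 6) * ((n : ℤ) ^ 2 + 9 * n - 12)) ∧
      ((n : ℤ) + 4) *
          (20 * (p + 1) + 1000 * (n + 3) * (n + 6) * ((n : ℤ) ^ 2 + 9 * n - 12)) <
        ((k : ℤ) + 1) * (20 * (2000 * ((n : ℤ) - 2) * (n + 6) + (n + 4) * p)) := by
    decide +kernel
  obtain ⟨p, -, k, -, h₁, h₂, h₃, h₄⟩ := H n (Finset.mem_Icc.2 ⟨hn, hn'⟩) h24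
  obtain ⟨hlo, hhi⟩ := b_six_mem_Ioo (by omega) p k h₁ h₂ h₃ h₄
  intro h
  rw [h] at hlo hhi
  have h5 : (k : ℤ) < m := by exact_mod_cast hlo
  have h6 : m < (k : ℤ) + 1 := by exact_mod_cast hhi
  omega

theorem radical_two : radical 2 = 20 := by
  rw [← sq_eq_sq₀ (radical_pos 2).le (by norm_num), radical_sq]; norm_num

theorem radical_twentyfour : radical 24 = 90 := by
  rw [← sq_eq_sq₀ (radical_pos 24).le (by norm_num), radical_sq]; norm_num

theorem b_two : b 2 6 = 2 := by
  rw [b_six le_rfl, radical_two]; norm_num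

theorem b_twentyfour : b 24 6 = 231 := by
  rw [b_six (by norm_num), radical_twentyfour]; norm_num

theorem alpha_twentyfour : alpha 24 = 1 / 2 := by
  rw [← sq_eq_sq₀ (alpha_pos 24).le (by norm_num), alpha_sq, radical_twentyfour]; norm_num

/-! ### Zonal harmonics. -/

/-- The linear form `x ↦ x · y`. -/
noncomputable def linForm {n : ℕ} (y : Fin n → ℝ) : MvPolynomial (Fin n) ℝ := ∑ i, C (y i) * X i

/-- The quadratic form `x ↦ x · x`. -/
noncomputable def normSqForm (n : ℕ) : MvPolynomial (Fin n) ℝ := ∑ i, X i ^ 2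

theorem pderiv_linForm {n : ℕ} (y : Fin n → ℝ) (i : Fin n) :
    pderiv i (linForm y) = C (y i) := by
  simp [linForm, pderiv_X, Pi.single_apply]

theorem pderiv_normSqForm {n : ℕ} (i : Fin n) :
    pderiv i (normSqForm n) = 2 * X i := by
  simp [normSqForm, pderiv_X, Pi.single_apply, Derivation.leibniz_pow]

theorem isHomogeneous_linForm {n : ℕ} (y : Fin n → ℝ) : (linForm y).IsHomogeneous 1 :=
  IsHomogeneous.sum _ _ _ fun i _ => by
    simpa using (isHomogeneous_C (Fin n) (y i)).mul (isHomogeneous_X ℝ i)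

theorem isHomogeneous_normSqForm (n : ℕ) : (normSqForm n).IsHomogeneous 2 :=
  IsHomogeneous.sum _ _ _ fun i _ => by
    simpa using (isHomogeneous_X ℝ i).pow 2

/-- The zonal harmonic of degree `6` with pole `y`, up to a constant factor. -/
noncomputable def zonal {n : ℕ} (y : Fin n → ℝ) : MvPolynomial (Fin n) ℝ :=
  C (((n : ℝ) + 4) * (n + 6) * (n + 8)) * linForm y ^ 6
    - C (15 * ((n : ℝ) + 4) * (n + 6)) * (linForm y ^ 4 * normSqForm n)
    + C (45 * ((n : ℝ) + 4)) * (linForm y ^ 2 * normSqForm n ^ 2)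
    - C 15 * normSqForm n ^ 3

theorem isHomogeneous_zonal {n : ℕ} (y : Fin n → ℝ) : (zonal y).IsHomogeneous 6 := by
  have hL := isHomogeneous_linForm y
  have hR := isHomogeneous_normSqForm n
  have h₁ := (isHomogeneous_C (Fin n) (((n : ℝ) + 4) * (n + 6) * (n + 8))).mul (hL.pow 6)
  have h₂ := (isHomogeneous_C (Fin n) (15 * ((n : ℝ) + 4) * (n + 6))).mul ((hL.pow 4).mul hR)
  have h₃ := (isHomogeneous_C (Fin n) (45 * ((n : ℝ) + 4))).mul ((hL.pow 2).mul (hR.pow 2))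
  have h₄ := (isHomogeneous_C (Fin n) (15 : ℝ)).mul (hR.pow 3)
  exact ((h₁.sub h₂).add h₃).sub h₄

/-- Each second derivative is a combination of `y_i²`, `y_i x_i`, `x_i²` and `1` with coefficients
free of `i`. Summed over `i`, these become `1`, `x · y`, `x · x` and `n`, and everything cancels. -/
theorem isHarmonicPoly_zonal {n : ℕ} (y : Fin n → ℝ) (hy : ∑ i, y i ^ 2 = 1) :
    IsHarmonicPoly (zonal y) := by
  have hL := pderiv_linForm y
  have hR := pderiv_normSqForm (n := n)
  have h1 : ∑ i, (C (y i) ^ 2 : MvPolynomial (Fin n) ℝ) = 1 := by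
    rw [← C_1, ← hy, map_sum]; simp
  have h2 : ∑ i, (C (y i) * X i : MvPolynomial (Fin n) ℝ) = linForm y := rfl
  have h3 : ∑ i, (X i ^ 2 : MvPolynomial (Fin n) ℝ) = normSqForm n := rfl
  set N : MvPolynomial (Fin n) ℝ := (n : MvPolynomial (Fin n) ℝ) with hN
  have h4 : ∑ _i : Fin n, (1 : MvPolynomial (Fin n) ℝ) = N := by simp [N]
  have key : ∀ i, pderiv i (pderiv i (zonal y)) =
      ((N + 4) * (N + 6) * (N + 8) * 30 * linForm y ^ 4
        - 15 * (N + 4) * (N + 6) * 12 * linForm y ^ 2 * normSqForm n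
        + 45 * (N + 4) * 2 * normSqForm n ^ 2) * C (y i) ^ 2
      + (- 15 * (N + 4) * (N + 6) * 16 * linForm y ^ 3
        + 45 * (N + 4) * 16 * linForm y * normSqForm n) * (C (y i) * X i)
      + (45 * (N + 4) * 8 * linForm y ^ 2 - 15 * 24 * normSqForm n) * X i ^ 2
      + (- 15 * (N + 4) * (N + 6) * 2 * linForm y ^ 4
        + 45 * (N + 4) * 4 * linForm y ^ 2 * normSqForm n
        - 15 * 6 * normSqForm n ^ 2) * 1 := by
    intro i
    have hnum : ∀ (k : ℕ) [k.AtLeastTwo],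
        pderiv i (OfNat.ofNat k : MvPolynomial (Fin n) ℝ) = 0 := fun k _ =>
      Derivation.map_natCast (pderiv i) k
    simp only [zonal, hnum, map_add, map_sub, Derivation.leibniz, Derivation.leibniz_pow, hL, hR,
      pderiv_C, pderiv_X_self, smul_eq_mul, nsmul_eq_mul, map_mul, map_natCast, map_ofNat,
      Nat.cast_ofNat, Nat.reduceSub, pow_one, mul_zero, zero_add, mul_one,
      Derivation.map_natCast]
    simp only [← hN]
    ring
  unfold IsHarmonicPoly
  rw [Finset.sum_congr rfl fun i _ => key i]
  simp only [Finset.sum_add_distrib, ← Finset.mul_sum, h1, h2, h3, h4]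
  ring

theorem eval_linForm {n : ℕ} (x y : EuclideanSpace ℝ (Fin n)) :
    eval (fun i => x i) (linForm fun i => y i) = inner ℝ x y := by
  simp [linForm, PiLp.inner_apply]

theorem eval_normSqForm {n : ℕ} (x : EuclideanSpace ℝ (Fin n)) :
    eval (fun i => x i) (normSqForm n) = ‖x‖ ^ 2 := by
  simp [normSqForm, EuclideanSpace.real_norm_sq_eq]

theorem gegenbauer_six_eval_inner {n : ℕ} (hn : 2 ≤ n) (x y : EuclideanSpace ℝ (Fin n))
    (hx : ‖x‖ = 1) : (gegenbauer n 6).eval (inner ℝ x y) =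
      (n : ℝ) * (n + 2) * (n + 10) / 720 * eval (fun i => x i) (zonal fun i => y i) := by
  rw [gegenbauer_six_eval hn]
  simp only [zonal, map_add, map_sub, map_mul, map_pow, eval_C, eval_linForm, eval_normSqForm, hx]
  ring

/-! ### The Fisher type bound and its case of equality. -/

theorem IsDesign.sum_gegenbauer {n : ℕ} (hn : 2 ≤ n) {Y : Finset (EuclideanSpace ℝ (Fin n))}
    (hY : IsDesign 6 Y) {y : EuclideanSpace ℝ (Fin n)} (hy : ‖y‖ = 1) :
    ∑ x ∈ Y, (gegenbauer n 6).eval (inner ℝ x y) = 0 := by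
  rw [Finset.sum_congr rfl fun x hx => gegenbauer_six_eval_inner hn x y (hY.on_sphere x hx),
    ← Finset.mul_sum, hY.sum_eq_zero _ (isHomogeneous_zonal _) (isHarmonicPoly_zonal _ _), mul_zero]
  rw [← EuclideanSpace.real_norm_sq_eq, hy, one_pow]

/-- The defect of the Fisher type bound as a sum of non-negative terms. -/
theorem IsDesign.sum_offDiag {n : ℕ} (hn : 2 ≤ n) {Y : Finset (EuclideanSpace ℝ (Fin n))}
    (hY : IsDesign 6 Y) :
    ∑ p ∈ Y.offDiag, ((gegenbauer n 6).eval (inner ℝ p.1 p.2) + c n 6) =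
      Y.card * c n 6 * (Y.card - b n 6) := by
  classical
  have h0 : ∑ p ∈ Y ×ˢ Y, (gegenbauer n 6).eval (inner ℝ p.1 p.2) = 0 := by
    rw [Finset.sum_product_right]
    exact Finset.sum_eq_zero fun y hy => hY.sum_gegenbauer hn (hY.on_sphere y hy)
  rw [← Finset.diag_union_offDiag, Finset.sum_union (Finset.disjoint_diag_offDiag Y),
    Finset.sum_diag] at h0
  have h1 : ∑ x ∈ Y, (gegenbauer n 6).eval (inner ℝ x x) = Y.card * (gegenbauer n 6).eval 1 := by
    rw [Finset.sum_congr rfl fun x hx => by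
      rw [real_inner_self_eq_norm_sq, hY.on_sphere x hx, one_pow], Finset.sum_const, nsmul_eq_mul]
  have h2 : (Y.offDiag.card : ℝ) = Y.card * Y.card - Y.card := by
    rw [Finset.offDiag_card, Nat.cast_sub (Nat.le_mul_self _), Nat.cast_mul]
  have hc := (c_six_pos hn).ne'
  rw [Finset.sum_add_distrib, Finset.sum_const, nsmul_eq_mul, h2, b]
  rw [h1] at h0
  field_simp
  linarith

theorem neg_c_le_gegenbauer {n : ℕ} (hn : 2 ≤ n) (x : ℝ) : -c n 6 ≤ (gegenbauer n 6).eval x := by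
  rw [c_six hn]; exact neg_minValue_le hn x

theorem IsDesign.b_le_card {n : ℕ} (hn : 2 ≤ n) {Y : Finset (EuclideanSpace ℝ (Fin n))}
    (hY : IsDesign 6 Y) : b n 6 ≤ Y.card := by
  have h := hY.sum_offDiag hn
  have h0 : 0 ≤ (Y.card : ℝ) * c n 6 * (Y.card - b n 6) := by
    rw [← h]
    exact Finset.sum_nonneg fun p _ => by linarith [neg_c_le_gegenbauer hn (inner ℝ p.1 p.2)]
  have hN : (0 : ℝ) < Y.card := by exact_mod_cast hY.nonempty.card_pos
  linarith [nonneg_of_mul_nonneg_right h0 (mul_pos hN (c_six_pos hn))]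

theorem IsDesign.isTight_iff {n : ℕ} (hn : 2 ≤ n) {Y : Finset (EuclideanSpace ℝ (Fin n))}
    (hY : IsDesign 6 Y) :
    IsTight 6 Y ↔ ∀ a ∈ innerProducts Y, (gegenbauer n 6).eval a = -c n 6 := by
  have h := hY.sum_offDiag hn
  have hN : (0 : ℝ) < Y.card := by exact_mod_cast hY.nonempty.card_pos
  have h1 : IsTight 6 Y ↔
      ∑ p ∈ Y.offDiag, ((gegenbauer n 6).eval (inner ℝ p.1 p.2) + c n 6) = 0 := by
    rw [h, mul_eq_zero, or_iff_right (mul_pos hN (c_six_pos hn)).ne', sub_eq_zero]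
    exact and_iff_right hY
  rw [h1, Finset.sum_eq_zero_iff_of_nonneg fun p _ => by
    linarith [neg_c_le_gegenbauer hn (inner ℝ p.1 p.2)]]
  constructor
  · rintro H _ ⟨x, hx, y, hy, hne, rfl⟩
    exact eq_neg_of_add_eq_zero_left (H (x, y) (Finset.mem_offDiag.2 ⟨hx, hy, hne⟩))
  · rintro H ⟨x, y⟩ hp
    obtain ⟨hx, hy, hne⟩ := Finset.mem_offDiag.1 hp
    rw [H _ ⟨x, hx, y, hy, hne, rfl⟩, neg_add_cancel]

theorem IsTight.inner_eq {n : ℕ} (hn : 3 ≤ n) {Y : Finset (EuclideanSpace ℝ (Fin n))}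
    (hY : IsTight 6 Y) {x y : EuclideanSpace ℝ (Fin n)} (hx : x ∈ Y) (hy : y ∈ Y) (hne : x ≠ y) :
    inner ℝ x y = alpha n ∨ inner ℝ x y = -alpha n := by
  have hn2 : 2 ≤ n := by omega
  rw [← gegenbauer_six_eq_iff hn, ← c_six hn2]
  exact (hY.1.isTight_iff hn2).1 hY _ ⟨x, hx, y, hy, hne, rfl⟩

/-! ### Linear algebra bounds for sets with few inner products. -/

/-- **Gerzon's bound** on the number of equiangular lines. -/
theorem card_le_of_equiangular {n : ℕ} {Y : Finset (EuclideanSpace ℝ (Fin n))} {a : ℝ}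
    (ha : a ^ 2 < 1) (hY : ∀ x ∈ Y, ‖x‖ = 1)
    (h : ∀ x ∈ Y, ∀ y ∈ Y, x ≠ y → inner ℝ x y ^ 2 = a ^ 2) : Y.card ≤ (n + 1).choose 2 := by
  classical
  -- The symmetric tensor `x ⊗ x`, recorded on unordered pairs so that the ambient dimension is `(n
  -- + 1).choose 2`.
  let q : EuclideanSpace ℝ (Fin n) → Sym2 (Fin n) → ℝ :=
    fun x => Sym2.lift ⟨fun i j => x i * x j, fun i j => mul_comm _ _⟩
  have hq : LinearIndependent ℝ fun x : Y => q x := by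
    rw [Fintype.linearIndependent_iff]
    intro g hg
    -- Pairing the relation with `y ⊗ y` turns tensors into squared inner products, which are `1` on
    -- the diagonal and `a ^ 2` off it.
    have h1 : ∀ y ∈ Y, ∑ x : Y, g x * inner ℝ (x : EuclideanSpace ℝ (Fin n)) y ^ 2 = 0 := by
      intro y _
      have h2 : ∀ i j, ∑ x : Y, g x * (x.1 i * x.1 j) = 0 := fun i j => by
        simpa [q] using congrFun hg s(i, j)
      calc ∑ x : Y, g x * inner ℝ (x : EuclideanSpace ℝ (Fin n)) y ^ 2
          = ∑ x : Y, ∑ i, ∑ j, y i * y j * (g x * (x.1 i * x.1 j)) := by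
            refine Finset.sum_congr rfl fun x _ => ?_
            rw [PiLp.inner_apply, sq, Finset.sum_mul_sum, Finset.mul_sum]
            refine Finset.sum_congr rfl fun i _ => ?_
            rw [Finset.mul_sum]
            refine Finset.sum_congr rfl fun j _ => ?_
            simp only [RCLike.inner_apply, conj_trivial]
            ring
        _ = ∑ i, ∑ j, y i * y j * ∑ x : Y, g x * (x.1 i * x.1 j) := by
            rw [Finset.sum_comm]
            refine Finset.sum_congr rfl fun i _ => ?_
            rw [Finset.sum_comm]
            simp only [Finset.mul_sum]
        _ = 0 := by simp only [h2, mul_zero, Finset.sum_const_zero]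
    have h3 : ∀ y : Y, (1 - a ^ 2) * g y + a ^ 2 * ∑ x, g x = 0 := by
      intro y
      rw [← h1 y y.2, Finset.mul_sum, ← Finset.add_sum_erase _ _ (Finset.mem_univ y),
        ← Finset.add_sum_erase (a := y) _ _ (Finset.mem_univ y), real_inner_self_eq_norm_sq,
        hY y y.2]
      have : ∑ x ∈ Finset.univ.erase y, g x * inner ℝ x.1 y.1 ^ 2 =
          ∑ x ∈ Finset.univ.erase y, a ^ 2 * g x :=
        Finset.sum_congr rfl fun x hx => by
          rw [h x x.2 y y.2 fun e => (Finset.mem_erase.1 hx).1 (Subtype.ext e), mul_comm]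
      rw [this, ← Finset.mul_sum]
      ring
    -- Adding the equations `h3` over all `y` isolates the total of the coefficients.
    have h4 : (1 - a ^ 2 + Y.card * a ^ 2) * ∑ x, g x = 0 := by
      have := Finset.sum_eq_zero fun (y : Y) (_ : y ∈ Finset.univ) => h3 y
      rw [Finset.sum_add_distrib, ← Finset.mul_sum, Finset.sum_const, Finset.card_univ,
        Fintype.card_coe, nsmul_eq_mul] at this
      linarith
    have h5 : ∑ x, g x = 0 := by
      refine (mul_eq_zero.1 h4).resolve_left (ne_of_gt ?_)
      have : 0 ≤ (Y.card : ℝ) * a ^ 2 := by positivity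
      linarith
    intro y
    have := h3 y
    rw [h5, mul_zero, add_zero] at this
    exact (mul_eq_zero.1 this).resolve_left (by linarith)
  simpa [Sym2.card] using hq.fintype_card_le_finrank

/-- A linear relation, paired with a vector `y`. -/
theorem sum_mul_inner_eq_zero {n : ℕ} {Y : Finset (EuclideanSpace ℝ (Fin n))}
    {f : EuclideanSpace ℝ (Fin n) → ℝ} (hf : ∑ x ∈ Y, f x • x = 0)
    (y : EuclideanSpace ℝ (Fin n)) : ∑ x ∈ Y, f x * inner ℝ x y = 0 := by
  have := congrArg (fun z => inner ℝ z y) hf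
  simpa [sum_inner, real_inner_smul_left] using this

/-- More than `n + 1` unit vectors cannot have all their inner products equal. -/
theorem exists_inner_ne {n : ℕ} {Y : Finset (EuclideanSpace ℝ (Fin n))} {a : ℝ}
    (ha : a ≠ 1) (hY : ∀ x ∈ Y, ‖x‖ = 1) (hcard : n + 1 < Y.card) :
    ∃ x ∈ Y, ∃ y ∈ Y, x ≠ y ∧ inner ℝ x y ≠ a := by
  classical
  by_contra! h
  -- More than `n + 1` points are affinely dependent: the coefficients of the relation also sum to
  -- zero.
  obtain ⟨f, hf, hf0, y, hy, hfy⟩ :=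
    Module.exists_nontrivial_relation_sum_zero_of_finrank_succ_lt_card (R := ℝ) (t := Y)
      (by simpa using hcard)
  have h1 := sum_mul_inner_eq_zero hf y
  rw [← Finset.add_sum_erase _ _ hy, real_inner_self_eq_norm_sq, hY y hy] at h1
  rw [← Finset.add_sum_erase _ _ hy] at hf0
  rw [Finset.sum_congr rfl fun x hx => by
    rw [h x (Finset.mem_of_mem_erase hx) y hy (Finset.ne_of_mem_erase hx)], ← Finset.sum_mul] at h1
  have : f y * (1 - a) = 0 := by linear_combination h1 - a * hf0
  exact hfy ((mul_eq_zero.1 this).resolve_right fun e => ha (by linarith))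

/-- Modulo 2 the matrix is the identity, so its determinant is odd. -/
theorem det_one_sub_two_smul_ne_zero {ι : Type*} [Fintype ι] [DecidableEq ι]
    (A : Matrix ι ι ℤ) : (1 - (2 : ℤ) • A).det ≠ 0 := by
  intro h
  have h2 : ((1 - (2 : ℤ) • A).map (Int.castRingHom (ZMod 2))) = 1 := by
    ext i j
    have : ((2 : ℤ) : ZMod 2) = 0 := rfl
    simp only [Matrix.map_apply, Matrix.sub_apply, Matrix.smul_apply, smul_eq_mul, map_sub,
      map_mul, eq_intCast, this, zero_mul, sub_zero, Matrix.one_apply]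
    split_ifs <;> simp
  have h3 := (Int.castRingHom (ZMod 2)).map_det (1 - (2 : ℤ) • A)
  rw [h, RingHom.mapMatrix_apply, h2, Matrix.det_one, map_zero] at h3
  exact zero_ne_one h3

/-- At most `n + 1` unit vectors in `ℝⁿ` have all their inner products equal to `±1/2`. -/
theorem card_le_of_inner_eq_half {n : ℕ} {Y : Finset (EuclideanSpace ℝ (Fin n))}
    (hY : ∀ x ∈ Y, ‖x‖ = 1)
    (h : ∀ x ∈ Y, ∀ y ∈ Y, x ≠ y → inner ℝ x y = 1 / 2 ∨ inner ℝ x y = -(1 / 2 : ℝ)) :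
    Y.card ≤ n + 1 := by
  classical
  by_contra! hcard
  obtain ⟨f, hf, hf0, z, hz, hfz⟩ :=
    Module.exists_nontrivial_relation_sum_zero_of_finrank_succ_lt_card (R := ℝ) (t := Y)
      (by simpa using hcard)
  -- With `G` the Gram matrix and `J` the all-ones matrix, `2G - J` has entries `1` on the diagonal
  -- and `0` or `-2` elsewhere, so it equals `1 - 2A`.
  let A : Matrix Y Y ℤ := fun y x => if inner ℝ x.1 y.1 = -(1 / 2 : ℝ) then 1 else 0
  let M : Matrix Y Y ℝ := (1 - (2 : ℤ) • A).map (Int.castRingHom ℝ)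
  have hM : ∀ y x : Y, M y x = 2 * inner ℝ x.1 y.1 - 1 := by
    intro y x
    have e : M y x = (if y = x then 1 else 0)
        - 2 * (if inner ℝ x.1 y.1 = -(1 / 2 : ℝ) then 1 else 0) := by
      have hA : A y x = if inner ℝ x.1 y.1 = -(1 / 2 : ℝ) then 1 else 0 := rfl
      simp only [M, Matrix.map_apply, Matrix.sub_apply, Matrix.smul_apply, smul_eq_mul,
        Matrix.one_apply, hA, eq_intCast]
      push_cast
      rfl
    rw [e]
    by_cases hxy : y = x
    · subst hxy
      rw [real_inner_self_eq_norm_sq, hY y y.2]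
      norm_num
    · rw [if_neg hxy]
      rcases h x x.2 y y.2 fun e => hxy (Subtype.ext e.symm) with h' | h' <;> rw [h'] <;> norm_num
  -- An affine dependence is killed by both `G` and `J`.
  have hMv : M.mulVec (fun x : Y => f x) = 0 := by
    ext y
    have h1 := sum_mul_inner_eq_zero hf y
    rw [← Finset.sum_coe_sort] at h1 hf0
    simp only [Matrix.mulVec, dotProduct, hM, Pi.zero_apply]
    rw [Finset.sum_congr rfl fun (x : Y) _ => show
      (2 * inner ℝ x.1 y.1 - 1) * f x = 2 * (f x * inner ℝ x.1 y.1) - f x by ring,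
      Finset.sum_sub_distrib, ← Finset.mul_sum, h1, hf0]
    simp
  have hdet : M.det = 0 :=
    Matrix.exists_mulVec_eq_zero_iff.1 ⟨_, fun e => hfz (congrFun e ⟨z, hz⟩), hMv⟩
  have hdet' := (Int.castRingHom ℝ).map_det (1 - (2 : ℤ) • A)
  rw [RingHom.mapMatrix_apply, show Matrix.map _ _ = M from rfl, hdet, eq_intCast,
    Int.cast_eq_zero] at hdet'
  exact det_one_sub_two_smul_ne_zero A hdet'

/-! ### Nonexistence in dimension at least 3. -/

/-- The size of a tight design is large, since `b_{n,6}` is rarely an integer. -/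
theorem IsTight.succ_lt_card {n : ℕ} (hn : 3 ≤ n) {Y : Finset (EuclideanSpace ℝ (Fin n))}
    (hY : IsTight 6 Y) : (n = 24 ∨ 37 ≤ n) ∧ n + 1 < Y.card := by
  rcases le_or_gt 37 n with h | h
  · refine ⟨Or.inr h, ?_⟩
    have h1 := triangular_lt_b_six h
    rw [← hY.2] at h1
    have h2 : (37 : ℝ) ≤ n := by exact_mod_cast h
    have : (n : ℝ) + 1 < Y.card := by nlinarith
    exact_mod_cast this
  · by_cases h24 : n = 24
    · subst h24
      have h1 := hY.2
      rw [b_twentyfour] at h1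
      have h2 : Y.card = 231 := by exact_mod_cast h1
      exact ⟨Or.inl rfl, by omega⟩
    · exact absurd hY.2.symm (by simpa using b_six_not_int hn (by omega) h24 Y.card)

/-- Were one sign missing, more than `n + 1` unit vectors would share a single inner product,
against `exists_inner_ne`. -/
theorem IsTight.innerProducts_eq {n : ℕ} (hn : 3 ≤ n) {Y : Finset (EuclideanSpace ℝ (Fin n))}
    (hY : IsTight 6 Y) : innerProducts Y = {alpha n, -alpha n} := by
  have hcard := (hY.succ_lt_card hn).2
  have hα := alpha_lt_one (by omega : 2 ≤ n)
  have hα' := alpha_pos n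
  apply Set.Subset.antisymm
  · rintro _ ⟨x, hx, y, hy, hne, rfl⟩
    exact hY.inner_eq hn hx hy hne
  · rintro _ (rfl | rfl)
    · obtain ⟨x, hx, y, hy, hne, h⟩ := exists_inner_ne (a := -alpha n) (by linarith)
        hY.1.on_sphere hcard
      exact ⟨x, hx, y, hy, hne, (hY.inner_eq hn hx hy hne).resolve_right h⟩
    · obtain ⟨x, hx, y, hy, hne, h⟩ := exists_inner_ne hα.ne hY.1.on_sphere hcard
      exact ⟨x, hx, y, hy, hne, (hY.inner_eq hn hx hy hne).resolve_left h⟩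

theorem not_isTight {n : ℕ} (hn : 3 ≤ n) (Y : Finset (EuclideanSpace ℝ (Fin n))) :
    ¬ IsTight 6 Y := by
  intro hY
  obtain ⟨rfl | h37, hcard⟩ := hY.succ_lt_card hn
  -- Gerzon's bound, which is 300 for `n = 24`, would not exclude 231 points; the parity bound does.
  · refine hcard.not_ge (card_le_of_inner_eq_half hY.1.on_sphere fun x hx y hy hne => ?_)
    simpa only [alpha_twentyfour] using hY.inner_eq hn hx hy hne
  · have h1 := card_le_of_equiangular (a := alpha n)
      (by nlinarith [alpha_pos n, alpha_lt_one (by omega : 2 ≤ n)]) hY.1.on_sphere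
      fun x hx y hy hne => by
        rcases hY.inner_eq hn hx hy hne with h | h <;> rw [h]
        ring
    have h2 := triangular_lt_b_six h37
    have h3 : (Y.card : ℝ) ≤ ((n + 1).choose 2 : ℕ) := by exact_mod_cast h1
    rw [Nat.cast_choose_two, hY.2] at h3
    push_cast at h3
    linarith

/-! ### Tight designs on the circle. -/

/-- The exponent `(k, l)` of a monomial in two variables. -/
noncomputable def biExp (k l : ℕ) : Fin 2 →₀ ℕ := Finsupp.single 0 k + Finsupp.single 1 l

@[simp] theorem biExp_zero (k l : ℕ) : biExp k l 0 = k := by simp [biExp]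

@[simp] theorem biExp_one (k l : ℕ) : biExp k l 1 = l := by simp [biExp]

theorem eq_biExp (d : Fin 2 →₀ ℕ) : d = biExp (d 0) (d 1) := by
  ext i; fin_cases i <;> simp

theorem eval_binary {t : ℕ} {f : MvPolynomial (Fin 2) ℝ} (hf : f.IsHomogeneous t)
    (x : Fin 2 → ℝ) :
    eval x f = ∑ k ∈ Finset.range (t + 1),
      coeff (biExp k (t - k)) f * (x 0 ^ k * x 1 ^ (t - k)) := by
  have hsub : f.support ⊆ (Finset.range (t + 1)).image fun k => biExp k (t - k) := by
    intro d hd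
    have h1 : d.degree = t := by
      by_contra h
      exact mem_support_iff.1 hd (hf.coeff_eq_zero h)
    rw [Finsupp.degree_eq_sum, Fin.sum_univ_two] at h1
    refine Finset.mem_image.2 ⟨d 0, Finset.mem_range.2 (by omega), ?_⟩
    rw [show t - d 0 = d 1 by omega, ← eq_biExp]
  rw [eval_eq', Finset.sum_subset hsub fun d _ hd => by rw [notMem_support_iff.1 hd, zero_mul],
    Finset.sum_image fun k _ l _ h => by simpa using DFunLike.congr_fun h 0]
  simp

/-- Reads off one coefficient of the Laplacian. The recurrence moves the exponent by two, so a
harmonic form of degree 6 is determined by its coefficients at `y^6` and `x y^5`. -/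
theorem IsHarmonicPoly.coeff_binary {f : MvPolynomial (Fin 2) ℝ} (hf : IsHarmonicPoly f)
    (k l : ℕ) : coeff (biExp (k + 2) l) f * ((k + 2) * (k + 1)) +
      coeff (biExp k (l + 2)) f * ((l + 2) * (l + 1)) = 0 := by
  have h := congrArg (coeff (biExp k l)) hf
  have h0 : biExp k l + Finsupp.single 0 1 + Finsupp.single 0 1 = biExp (k + 2) l := by
    ext i; fin_cases i <;> simp [biExp]
  have h1 : biExp k l + Finsupp.single 1 1 + Finsupp.single 1 1 = biExp k (l + 2) := by
    ext i; fin_cases i <;> simp [biExp]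
  rw [Fin.sum_univ_two, coeff_add, coeff_pderiv, coeff_pderiv, coeff_pderiv, coeff_pderiv, h0, h1,
    coeff_zero] at h
  simp at h
  linear_combination h

/-- A binary harmonic form of degree `6` is a linear combination of the real and imaginary parts
of `z ^ 6`. -/
theorem eval_harmonic_six {f : MvPolynomial (Fin 2) ℝ} (hf : f.IsHomogeneous 6)
    (hh : IsHarmonicPoly f) : ∃ a b : ℝ, ∀ x : Fin 2 → ℝ,
      eval x f = a * ((⟨x 0, x 1⟩ : ℂ) ^ 6).re + b * ((⟨x 0, x 1⟩ : ℂ) ^ 6).im := by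
  -- `Re z^6` contains `-y^6` and `Im z^6` contains `6 x y^5`.
  refine ⟨-coeff (biExp 0 6) f, coeff (biExp 1 5) f / 6, fun x => ?_⟩
  have h0 := hh.coeff_binary 0 4
  have h1 := hh.coeff_binary 1 3
  have h2 := hh.coeff_binary 2 2
  have h3 := hh.coeff_binary 3 1
  have h4 := hh.coeff_binary 4 0
  rw [eval_binary hf]
  simp only [Finset.sum_range_succ, Finset.sum_range_zero, zero_add, Nat.reduceAdd, Nat.reduceSub,
    Nat.cast_zero, Nat.cast_one, Nat.cast_ofNat] at h0 h1 h2 h3 h4 ⊢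
  have e2 : coeff (biExp 2 4) f = -15 * coeff (biExp 0 6) f := by linarith
  have e3 : coeff (biExp 3 3) f = -10 / 3 * coeff (biExp 1 5) f := by linarith
  have e4 : coeff (biExp 4 2) f = 15 * coeff (biExp 0 6) f := by linarith
  have e5 : coeff (biExp 5 1) f = coeff (biExp 1 5) f := by linarith
  have e6 : coeff (biExp 6 0) f = -coeff (biExp 0 6) f := by linarith
  rw [e2, e3, e4, e5, e6]
  simp only [pow_succ, pow_zero, one_mul, Complex.mul_re, Complex.mul_im]
  ring

theorem gegenbauer_two_cos (θ : ℝ) : (gegenbauer 2 6).eval (Real.cos θ) = 2 * Real.cos (6 * θ) := by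
  rw [gegenbauer_six_eval le_rfl, show 6 * θ = 2 * (3 * θ) by ring, Real.cos_two_mul,
    Real.cos_three_mul]
  push_cast
  ring

theorem c_two : c 2 6 = 2 := by
  rw [c_six le_rfl, minValue, radical_two]; norm_num

theorem cos_six_angle_eq_iff (y₁ y₂ : EuclideanSpace ℝ (Fin 2)) :
    Real.cos (6 * InnerProductGeometry.angle y₁ y₂) = -1 ↔
      ∃ j : ℕ, Odd j ∧ InnerProductGeometry.angle y₁ y₂ = (j : ℝ) * Real.pi / 6 := by
  have h0 := InnerProductGeometry.angle_nonneg y₁ y₂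
  generalize InnerProductGeometry.angle y₁ y₂ = θ at *
  rw [Real.cos_eq_neg_one_iff]
  constructor
  · rintro ⟨k, hk⟩
    have hk' : 0 ≤ ((2 * k + 1 : ℤ) : ℝ) := by
      refine nonneg_of_mul_nonneg_left (b := Real.pi) ?_ Real.pi_pos
      push_cast
      linarith
    have hk0 : 0 ≤ 2 * k + 1 := by exact_mod_cast hk'
    lift k to ℕ using by omega
    refine ⟨2 * k + 1, ⟨k, rfl⟩, ?_⟩
    push_cast at hk ⊢
    linarith
  · rintro ⟨j, ⟨k, rfl⟩, h⟩
    refine ⟨k, ?_⟩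
    rw [h]
    push_cast
    ring

/-- Two points on the circle whose angle `θ` has `cos 6θ = -1` have opposite sixth powers. -/
theorem pow_six_eq_neg {y₁ y₂ : EuclideanSpace ℝ (Fin 2)} (h₁ : ‖y₁‖ = 1) (h₂ : ‖y₂‖ = 1)
    (h : (gegenbauer 2 6).eval (inner ℝ y₁ y₂) = -2) :
    (⟨y₂ 0, y₂ 1⟩ : ℂ) ^ 6 = -(⟨y₁ 0, y₁ 1⟩ : ℂ) ^ 6 := by
  have n₁ : y₁ 0 ^ 2 + y₁ 1 ^ 2 = 1 := by
    rw [← Fin.sum_univ_two fun i => y₁ i ^ 2, ← EuclideanSpace.real_norm_sq_eq, h₁, one_pow]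
  have n₂ : y₂ 0 ^ 2 + y₂ 1 ^ 2 = 1 := by
    rw [← Fin.sum_univ_two fun i => y₂ i ^ 2, ← EuclideanSpace.real_norm_sq_eq, h₂, one_pow]
  have hp : inner ℝ y₁ y₂ = y₁ 0 * y₂ 0 + y₁ 1 * y₂ 1 := by
    simp [PiLp.inner_apply, mul_comm]
  set p : ℝ := y₁ 0 * y₂ 0 + y₁ 1 * y₂ 1 with hp'
  set q : ℝ := y₁ 0 * y₂ 1 - y₁ 1 * y₂ 0 with hq'
  have hpq : q ^ 2 = 1 - p ^ 2 := by
    rw [hp', hq']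
    linear_combination (y₂ 0 ^ 2 + y₂ 1 ^ 2) * n₁ + n₂
  -- The rotation `p + iq` is the quotient of the two points, with `p` their inner product; the real
  -- part of its sixth power is `Q_{2,6}(p) / 2`.
  have hmul : (⟨y₂ 0, y₂ 1⟩ : ℂ) = ⟨y₁ 0, y₁ 1⟩ * ⟨p, q⟩ := by
    apply Complex.ext
    · simp only [Complex.mul_re, hp', hq']
      linear_combination -(y₂ 0) * n₁
    · simp only [Complex.mul_im, hp', hq']
      linear_combination -(y₂ 1) * n₁
  have hre : ((⟨p, q⟩ : ℂ) ^ 6).re = -1 := by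
    rw [hp, gegenbauer_six_eval le_rfl] at h
    push_cast at h
    have e : ((⟨p, q⟩ : ℂ) ^ 6).re =
        p ^ 6 - 15 * p ^ 4 * q ^ 2 + 15 * p ^ 2 * (q ^ 2) ^ 2 - (q ^ 2) ^ 3 := by
      simp only [pow_succ, pow_zero, one_mul, Complex.mul_re, Complex.mul_im]
      ring
    rw [e, hpq]
    linear_combination h / 2
  have hnorm : Complex.normSq ((⟨p, q⟩ : ℂ) ^ 6) = 1 := by
    rw [map_pow, Complex.normSq_mk, ← sq, ← sq, hpq]
    ring
  -- A number of modulus one with real part `-1` is `-1`.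
  have him : ((⟨p, q⟩ : ℂ) ^ 6).im = 0 := by
    rw [Complex.normSq_apply, hre] at hnorm
    exact mul_self_eq_zero.1 (by linarith)
  have : (⟨p, q⟩ : ℂ) ^ 6 = -1 := Complex.ext (by simpa using hre) (by simpa using him)
  rw [hmul, mul_pow, this, mul_neg_one]

theorem gegenbauer_two_inner {y₁ y₂ : EuclideanSpace ℝ (Fin 2)} (h₁ : ‖y₁‖ = 1) (h₂ : ‖y₂‖ = 1) :
    (gegenbauer 2 6).eval (inner ℝ y₁ y₂) = -2 ↔
      ∃ j : ℕ, Odd j ∧ InnerProductGeometry.angle y₁ y₂ = (j : ℝ) * Real.pi / 6 := by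
  have hi : inner ℝ y₁ y₂ = Real.cos (InnerProductGeometry.angle y₁ y₂) := by
    rw [InnerProductGeometry.cos_angle, h₁, h₂, mul_one, div_one]
  rw [← cos_six_angle_eq_iff, hi, gegenbauer_two_cos]
  constructor <;> intro h <;> linarith

theorem isTight_circle_iff (Y : Finset (EuclideanSpace ℝ (Fin 2))) : IsTight 6 Y ↔
    ∃ y₁ y₂ : EuclideanSpace ℝ (Fin 2), ‖y₁‖ = 1 ∧ ‖y₂‖ = 1 ∧
      (∃ j : ℕ, Odd j ∧ InnerProductGeometry.angle y₁ y₂ = (j : ℝ) * Real.pi / 6) ∧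
      (Y : Set (EuclideanSpace ℝ (Fin 2))) = {y₁, y₂} := by
  classical
  constructor
  · intro hY
    have hcard := hY.2
    rw [b_two] at hcard
    obtain ⟨y₁, y₂, hne, rfl⟩ := Finset.card_eq_two.1 (by exact_mod_cast hcard : Y.card = 2)
    have m₁ : y₁ ∈ ({y₁, y₂} : Finset _) := by simp
    have m₂ : y₂ ∈ ({y₁, y₂} : Finset _) := by simp
    have h₁ := hY.1.on_sphere y₁ m₁
    have h₂ := hY.1.on_sphere y₂ m₂
    refine ⟨y₁, y₂, h₁, h₂, (gegenbauer_two_inner h₁ h₂).1 ?_, by simp⟩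
    rw [← c_two]
    exact (hY.1.isTight_iff le_rfl).1 hY _ ⟨y₁, m₁, y₂, m₂, hne, rfl⟩
  · rintro ⟨y₁, y₂, h₁, h₂, hj, hY⟩
    obtain rfl : Y = {y₁, y₂} := Finset.coe_injective (by simpa using hY)
    have hQ := (gegenbauer_two_inner h₁ h₂).2 hj
    -- Equal points have angle `0`, which is not an odd multiple of `π/6`.
    have hne : y₁ ≠ y₂ := by
      rintro rfl
      obtain ⟨j, hodd, h⟩ := hj
      rw [InnerProductGeometry.angle_self (by rintro rfl; simp at h₁)] at h
      have : (j : ℝ) = 0 := by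
        have := Real.pi_pos
        by_contra hj0
        have : (j : ℝ) * Real.pi / 6 ≠ 0 := by positivity
        exact this h.symm
      rw [Nat.cast_eq_zero.1 this] at hodd
      exact absurd hodd (by decide)
    refine ⟨⟨by simp, ?_, fun f hf hh => ?_⟩, ?_⟩
    · intro x hx
      rcases Finset.mem_insert.1 hx with rfl | hx
      · exact h₁
      · rwa [Finset.mem_singleton.1 hx]
    · obtain ⟨a, b, hab⟩ := eval_harmonic_six hf hh
      rw [Finset.sum_pair hne, hab, hab, pow_six_eq_neg h₁ h₂ hQ, Complex.neg_re, Complex.neg_im]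
      ring
    · rw [Finset.card_pair hne, b_two, Nat.cast_ofNat]

end HarmonicIndex

theorem mainTheorem1 :
    -- there is no tight design of harmonic index 6 in dimension at least 3
    (∀ n : ℕ, 3 ≤ n →
      ¬ ∃ Y : Finset (EuclideanSpace ℝ (Fin n)), HarmonicIndex.IsTight 6 Y) ∧
    -- on the circle the tight designs are exactly the two-point sets at an odd multiple of `π/6`
    (∀ Y : Finset (EuclideanSpace ℝ (Fin 2)), HarmonicIndex.IsTight 6 Y ↔
      ∃ y₁ y₂ : EuclideanSpace ℝ (Fin 2), ‖y₁‖ = 1 ∧ ‖y₂‖ = 1 ∧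
        (∃ j : ℕ, Odd j ∧ InnerProductGeometry.angle y₁ y₂ = (j : ℝ) * Real.pi / 6) ∧
        (Y : Set (EuclideanSpace ℝ (Fin 2))) = {y₁, y₂}) ∧
    -- the lower bound, with the case of equality
    (∀ n : ℕ, 2 ≤ n → ∀ Y : Finset (EuclideanSpace ℝ (Fin n)), HarmonicIndex.IsDesign 6 Y →
      HarmonicIndex.b n 6 ≤ (Y.card : ℝ) ∧
      (HarmonicIndex.IsTight 6 Y ↔ ∀ a ∈ HarmonicIndex.innerProducts Y,
        (HarmonicIndex.gegenbauer n 6).eval a = -HarmonicIndex.c n 6)) ∧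
    -- the minimum of `Q_{n,6}` is attained at exactly the two points `±α`
    (∀ n : ℕ, 3 ≤ n →
      {x : ℝ | x ∈ Set.Icc (-1) 1 ∧
        (HarmonicIndex.gegenbauer n 6).eval x = -HarmonicIndex.c n 6} =
          {HarmonicIndex.alpha n, -HarmonicIndex.alpha n}) ∧
    -- a tight design is a 2-distance set with inner products `±α`, of size `b_{n,6}`
    (∀ n : ℕ, 3 ≤ n → ∀ Y : Finset (EuclideanSpace ℝ (Fin n)), HarmonicIndex.IsTight 6 Y →
      HarmonicIndex.innerProducts Y = {HarmonicIndex.alpha n, -HarmonicIndex.alpha n} ∧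
      (Y.card : ℝ) = HarmonicIndex.b n 6) ∧
    -- closed forms of `c_{n,6}` and `b_{n,6}`
    (∀ n : ℕ, 2 ≤ n →
      HarmonicIndex.c n 6 =
        (n : ℝ) * (n + 2) * (n + 10) *
          (2 * ((n : ℝ) - 2) * (n + 3) * (n + 6) +
            ((n : ℝ) + 3) * (n + 4) * √(10 * ((n : ℝ) + 3) * (n + 6))) /
          (36 * ((n : ℝ) + 6) * ((n : ℝ) + 8) ^ 2) ∧
      HarmonicIndex.b n 6 =
        ((n : ℝ) + 4) * (20 * √(10 * ((n : ℝ) + 3) * (n + 6)) +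
            ((n : ℝ) + 3) * (n + 6) * ((n : ℝ) ^ 2 + 9 * n - 12)) /
          (20 * (2 * ((n : ℝ) - 2) * (n + 6) +
            ((n : ℝ) + 4) * √(10 * ((n : ℝ) + 3) * (n + 6))))) ∧
    -- for large `n` the size exceeds the bound for 2-distance sets
    (∀ n : ℕ, 37 ≤ n → (n : ℝ) * (n + 1) / 2 < HarmonicIndex.b n 6) ∧
    -- for small `n` the number `b_{n,6}` is an integer only for `n = 2` and `n = 24`
    (∀ n : ℕ, 2 ≤ n → n ≤ 36 →
      ((∃ m : ℤ, HarmonicIndex.b n 6 = (m : ℝ)) ↔ n = 2 ∨ n = 24)) ∧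
    HarmonicIndex.b 2 6 = 2 ∧ HarmonicIndex.b 24 6 = 231 := by
  refine ⟨fun n hn ⟨Y, hY⟩ => HarmonicIndex.not_isTight hn Y hY,
    HarmonicIndex.isTight_circle_iff,
    fun n hn Y hY => ⟨hY.b_le_card hn, hY.isTight_iff hn⟩, fun n hn => ?_,
    fun n hn Y hY => ⟨hY.innerProducts_eq hn, hY.2⟩,
    fun n hn => ⟨HarmonicIndex.c_six hn, HarmonicIndex.b_six hn⟩,
    fun n hn => HarmonicIndex.triangular_lt_b_six hn, fun n hn hn' => ?_,
    HarmonicIndex.b_two, HarmonicIndex.b_twentyfour⟩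
  · have hα := HarmonicIndex.alpha_lt_one (by omega : 2 ≤ n)
    have hα' := HarmonicIndex.alpha_pos n
    ext x
    rw [Set.mem_ofPred_eq, HarmonicIndex.c_six (by omega), HarmonicIndex.gegenbauer_six_eq_iff hn]
    refine ⟨fun h => h.2, fun h => ⟨?_, h⟩⟩
    rcases h with rfl | rfl <;> constructor <;> linarith
  · constructor
    · rintro ⟨m, hm⟩
      by_contra! h
      exact HarmonicIndex.b_six_not_int (by omega) hn' h.2 m hm
    · rintro (rfl | rfl)
      · exact ⟨2, by rw [HarmonicIndex.b_two]; norm_num⟩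
      · exact ⟨231, by rw [HarmonicIndex.b_twentyfour]; norm_num⟩
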